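/- Let $S$ be a real or complex inner product space (pre-Hilbert space). For $A\subseteq S$ put $A^{\perp}=\{x\in S:\langle x,a\rangle=0\ \forall a\in A\}$; a linear subspace $M$ of $S$ is orthogonally closed if $M=M^{\perp\perp}$. A *pre-Hilbert space logic* $(S,\mathcal L)$ is a family $\mathcal L$ of orthogonally closed linear subspaces of $S$ such that $\{0\}\in\mathcal L$, $M^{\perp}\in\mathcal L$ for every $M\in\mathcal L$, and $M+\mathrm{span}\{u\}\in\mathcal L$ for all $M\in\mathcal L$, $u\in S$; it is partially ordered by inclusion. Let $F(S)$ be the logic of all orthogonally closed linear subspaces of $S$. $\mathcal L$ is *atomic $\sigma$-complete* if every sequence of pairwise orthogonal atoms of $\mathcal L$ has a supremum in $\mathcal L$. In a poset $P$, a net $(x_\gamma)_{\gamma\in\Gamma}$ *o-converges* to $x\in P$ if there are nets $(a_\gamma)_{\gamma\in\Gamma}$ and $(b_\gamma)_{\gamma\in\Gamma}$ in $P$ with $a_\gamma\le x_\gamma\le b_\gamma$ for all $\gamma$, $(a_\gamma)$ increasing with supremum $x$ and $(b_\gamma)$ decreasing with infimum $x$. The *order topology* $\tau_o(P)$ is the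 topology whose closed sets are the sets $X\subseteq P$ such that no net in $X$ o-converges to a point outside $X$. A linear subspace $M$ of $S$ is *splitting* if $M\oplus M^{\perp}=S$. Its *orthogonal dimension* is the cardinality of any maximal orthonormal system in $M$, i.e. of any orthonormal set $A\subseteq M$ with $A^{\perp}\cap M=\{0\}$. Let $(S,\mathcal L)$ be a pre-Hilbert space logic such that $S$ is incomplete. (i) If $\mathcal L$ is atomic $\sigma$-complete, then $\tau_o(\mathcal L)$ is not Hausdorff. In particular, $\tau_o(F(S))$ is not Hausdorff. (ii) If $\mathcal L$ contains an incomplete splitting subspace of $S$ whose orthogonal dimension is countable (at most $\aleph_0$), then $\tau_o(\mathcal L)$ is not Hausdorff. -/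

import Mathlib

namespace PreHilbert

section OrderTopology

universe u v

/-- A net `x` indexed by a directed set `Γ` o-converges to `l` if there are nets `a`, `b` with
`a γ ≤ x γ ≤ b γ` for all `γ`, `a` increasing with supremum `l`, and `b` decreasing with
infimum `l`. -/
def OConverges {P : Type u} [PartialOrder P] {Γ : Type v} [Preorder Γ] (x : Γ → P) (l : P) :
    Prop :=
  ∃ a b : Γ → P, (∀ γ, a γ ≤ x γ ∧ x γ ≤ b γ) ∧
    (Monotone a ∧ IsLUB (Set.range a) l) ∧ (Antitone b ∧ IsGLB (Set.range b) l)

/-- A set is o-closed if no net in it o-converges to a point outside of it. The index sets range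
over the universe of `P`; by `IsOClosed.mem_of_oConverges` this covers nets indexed in any
universe. -/
def IsOClosed {P : Type u} [PartialOrder P] (X : Set P) : Prop :=
  ∀ (Γ : Type u) [Preorder Γ] [IsDirectedOrder Γ] [Nonempty Γ] (x : Γ → P) (l : P),
    (∀ γ, x γ ∈ X) → OConverges x l → l ∈ X

theorem IsOClosed.mem_of_oConverges {P : Type u} [PartialOrder P] {X : Set P} (hX : IsOClosed X)
    {Γ : Type v} [Preorder Γ] [IsDirectedOrder Γ] [Nonempty Γ] (x : Γ → P) (l : P)
    (hx : ∀ γ, x γ ∈ X) (h : OConverges x l) : l ∈ X := by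
  obtain ⟨a, b, hab, ⟨ha, hal⟩, hb, hbl⟩ := h
  -- reindex the net by the set of values `(a γ, b γ, x γ)`, preordered by the first two entries
  let f : Γ → P × Pᵒᵈ × P := fun γ => (a γ, OrderDual.toDual (b γ), x γ)
  let Δ : Type u := Set.range f
  let pre : Preorder Δ :=
    Preorder.lift (fun d : Δ => ((d.1.1, d.1.2.1) : P × Pᵒᵈ))
  have ne : Nonempty Δ := ⟨⟨f (Classical.arbitrary Γ), Set.mem_range_self _⟩⟩
  have dir : @IsDirectedOrder Δ pre.toLE := @IsDirected.mk Δ _ <| by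
    rintro ⟨_, γ, rfl⟩ ⟨_, δ, rfl⟩
    obtain ⟨ε, h1, h2⟩ := exists_ge_ge γ δ
    refine ⟨⟨f ε, Set.mem_range_self _⟩, ?_, ?_⟩
    · exact (show (a γ, OrderDual.toDual (b γ)) ≤ (a ε, OrderDual.toDual (b ε)) from
        ⟨ha h1, hb h1⟩)
    · exact (show (a δ, OrderDual.toDual (b δ)) ≤ (a ε, OrderDual.toDual (b ε)) from
        ⟨ha h2, hb h2⟩)
  refine @hX Δ pre dir ne (fun d => d.1.2.2) l ?_
    ⟨fun d => d.1.1, fun d => OrderDual.ofDual d.1.2.1, ?_, ⟨?_, ?_⟩, ?_, ?_⟩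
  · rintro ⟨_, γ, rfl⟩
    exact hx γ
  · rintro ⟨_, γ, rfl⟩
    exact hab γ
  · exact fun d e h => h.1
  · convert hal using 1
    ext p
    constructor
    · rintro ⟨⟨_, γ, rfl⟩, rfl⟩
      exact ⟨γ, rfl⟩
    · rintro ⟨γ, rfl⟩
      exact ⟨⟨f γ, γ, rfl⟩, rfl⟩
  · exact fun d e h => h.2
  · convert hbl using 1
    ext p
    constructor
    · rintro ⟨⟨_, γ, rfl⟩, rfl⟩
      exact ⟨γ, rfl⟩
    · rintro ⟨γ, rfl⟩
      exact ⟨⟨f γ, γ, rfl⟩, rfl⟩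

/-- O-convergence passes to cofinal subnets. -/
theorem OConverges.restrict {P : Type u} [PartialOrder P] {Γ : Type v} [Preorder Γ]
    {x : Γ → P} {l : P} (h : OConverges x l) (C : Set Γ) (hC : ∀ γ, ∃ δ ∈ C, γ ≤ δ) :
    OConverges (fun γ : C => x γ) l := by
  obtain ⟨a, b, hab, ⟨ha, hal⟩, hb, hbl⟩ := h
  refine ⟨fun γ => a γ, fun γ => b γ, fun γ => hab γ, ⟨fun _ _ h => ha h, ?_, ?_⟩,
    fun _ _ h => hb h, ?_, ?_⟩
  · rintro _ ⟨γ, rfl⟩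
    exact hal.1 ⟨γ, rfl⟩
  · intro y hy
    refine hal.2 ?_
    rintro _ ⟨γ, rfl⟩
    obtain ⟨δ, hδ, hγ⟩ := hC γ
    exact (ha hγ).trans (hy ⟨⟨δ, hδ⟩, rfl⟩)
  · rintro _ ⟨γ, rfl⟩
    exact hbl.1 ⟨γ, rfl⟩
  · intro y hy
    refine hbl.2 ?_
    rintro _ ⟨γ, rfl⟩
    obtain ⟨δ, hδ, hγ⟩ := hC γ
    exact le_trans (hy ⟨⟨δ, hδ⟩, rfl⟩) (hb hγ)

theorem IsOClosed.union {P : Type u} [PartialOrder P] {X Y : Set P} (hX : IsOClosed X)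
    (hY : IsOClosed Y) : IsOClosed (X ∪ Y) := by
  intro Γ _ _ _ x l hx h
  have key : ∀ Z : Set P, IsOClosed Z → (∀ γ, ∃ δ, x δ ∈ Z ∧ γ ≤ δ) → l ∈ Z := by
    intro Z hZ hC
    let C : Set Γ := {γ | x γ ∈ Z}
    have : Nonempty C := by
      obtain ⟨δ, hδ, _⟩ := hC (Classical.arbitrary Γ)
      exact ⟨⟨δ, hδ⟩⟩
    have : IsDirectedOrder C := ⟨by
      intro p q
      obtain ⟨ε, h1, h2⟩ := exists_ge_ge p.1 q.1
      obtain ⟨δ, hδ, hε⟩ := hC ε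
      exact ⟨⟨δ, hδ⟩, h1.trans hε, h2.trans hε⟩⟩
    exact hZ C (fun γ : C => x γ) l (fun γ => γ.2) (h.restrict C hC)
  by_cases hC : ∀ γ, ∃ δ, x δ ∈ X ∧ γ ≤ δ
  · exact Or.inl (key X hX hC)
  · push Not at hC
    obtain ⟨γ₀, hγ₀⟩ := hC
    refine Or.inr (key Y hY fun γ => ?_)
    obtain ⟨ε, h1, h2⟩ := exists_ge_ge γ γ₀
    exact ⟨ε, (hx ε).resolve_left fun hε => hγ₀ ε hε h2, h1⟩

/-- The order topology `τ_o(P)`: its closed sets are exactly the o-closed sets. (This is not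
Mathlib's `OrderTopology`, which is generated by open rays.) -/
@[reducible]
def oTopology (P : Type u) [PartialOrder P] : TopologicalSpace P :=
  TopologicalSpace.ofClosed {X : Set P | IsOClosed X}
    (fun Γ _ _ _ _ _ hx _ => (hx (Classical.arbitrary Γ)).elim)
    (fun _ hA Γ _ _ _ x l hx h X hX => hA hX Γ x l (fun γ => hx γ X hX) h)
    (fun _ hX _ hY => IsOClosed.union hX hY)

theorem isClosed_oTopology_iff {P : Type u} [PartialOrder P] (X : Set P) :
    @IsClosed P (oTopology P) X ↔ IsOClosed X := by
  rw [← @isOpen_compl_iff P X (oTopology P)]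
  change IsOClosed Xᶜᶜ ↔ IsOClosed X
  rw [compl_compl]

end OrderTopology

section Logic

variable (𝕜 : Type*) [RCLike 𝕜] (S : Type*) [NormedAddCommGroup S] [InnerProductSpace 𝕜 S]

/-- A pre-Hilbert space logic `(S, 𝓛)`: a family `𝓛` of orthogonally closed linear subspaces of
`S` that contains `{0}` and is closed under `M ↦ Mᗮ` and under `M ↦ M + [u]`, `u ∈ S`. -/
structure Logic where
  carrier : Set (Submodule 𝕜 S)
  orthClosed : ∀ M ∈ carrier, Mᗮᗮ = M
  bot_mem : ⊥ ∈ carrier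
  orthogonal_mem : ∀ M ∈ carrier, Mᗮ ∈ carrier
  sup_span_mem : ∀ M ∈ carrier, ∀ u : S, M ⊔ Submodule.span 𝕜 {u} ∈ carrier

variable {𝕜 S}

instance : SetLike (Logic 𝕜 S) (Submodule 𝕜 S) where
  coe L := L.carrier
  coe_injective L₁ L₂ h := by
    cases L₁
    cases L₂
    congr

/-- `𝓛`, ordered by inclusion, has least element `{0}`. -/
instance (L : Logic 𝕜 S) : OrderBot L where
  bot := ⟨⊥, L.bot_mem⟩
  bot_le M := (bot_le : (⊥ : Submodule 𝕜 S) ≤ M)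

/-- `𝓛` is atomic σ-complete: each sequence of pairwise orthogonal atoms of the poset `𝓛` has a
supremum in `𝓛`. -/
def Logic.IsAtomicSigmaComplete (L : Logic 𝕜 S) : Prop :=
  ∀ a : ℕ → L, (∀ n, IsAtom (a n)) →
    (∀ m n, m ≠ n → (a m : Submodule 𝕜 S) ⟂ (a n : Submodule 𝕜 S)) →
    ∃ s : L, IsLUB (Set.range a) s

/-- If `M` is orthogonally closed, then so is `M + [u]`. -/
theorem orthClosed_sup_span (M : Submodule 𝕜 S) (hM : Mᗮᗮ = M) (u : S) :
    (M ⊔ Submodule.span 𝕜 {u})ᗮᗮ = M ⊔ Submodule.span 𝕜 {u} := by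
  refine le_antisymm ?_ (Submodule.le_orthogonal_orthogonal _)
  by_cases hu : u ∈ M
  · rw [sup_eq_left.2 ((Submodule.span_singleton_le_iff_mem u M).2 hu), hM]
  intro x hx
  obtain ⟨n₀, hn₀, hne⟩ : ∃ n ∈ Mᗮ, inner 𝕜 n u ≠ 0 := by
    by_contra hcon
    push Not at hcon
    exact hu (hM ▸ (Submodule.mem_orthogonal Mᗮ u).2 hcon)
  have hxM : x - (inner 𝕜 n₀ x / inner 𝕜 n₀ u) • u ∈ M := by
    rw [← hM, Submodule.mem_orthogonal]
    intro n hn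
    have hmem : n - (starRingEnd 𝕜 (inner 𝕜 n u / inner 𝕜 n₀ u)) • n₀ ∈
        (M ⊔ Submodule.span 𝕜 {u})ᗮ := by
      rw [← Submodule.inf_orthogonal]
      refine ⟨sub_mem hn (Submodule.smul_mem _ _ hn₀), ?_⟩
      rw [SetLike.mem_coe, Submodule.mem_orthogonal_singleton_iff_inner_left, inner_sub_left,
        inner_smul_left, RCLike.conj_conj, div_mul_cancel₀ _ hne, sub_self]
    have h := (Submodule.mem_orthogonal _ _).1 hx _ hmem
    rw [inner_sub_left, inner_smul_left, RCLike.conj_conj] at h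
    rw [inner_sub_right, inner_smul_right, ← h]
    ring
  have := Submodule.add_mem_sup hxM (Submodule.smul_mem _ (inner 𝕜 n₀ x / inner 𝕜 n₀ u)
    (Submodule.mem_span_singleton_self u))
  simpa using this

variable (𝕜 S)

/-- `F(S)`: the logic of all orthogonally closed linear subspaces of `S`. -/
def orthClosedLogic : Logic 𝕜 S where
  carrier := {M | Mᗮᗮ = M}
  orthClosed _ h := h
  bot_mem := by simp
  orthogonal_mem M h := congrArg Submodule.orthogonal h
  sup_span_mem M h u := orthClosed_sup_span M h u

variable {𝕜 S}

/-- `M` is a splitting subspace of `S`: `S = M ⊕ Mᗮ`. -/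
def IsSplitting (M : Submodule 𝕜 S) : Prop := IsCompl M Mᗮ

/-- `A` is a maximal orthonormal system in the linear subspace `M`: an orthonormal set contained
in `M` such that only the zero vector of `M` is orthogonal to all of `A`. -/
def IsMONS (M : Submodule 𝕜 S) (A : Set S) : Prop :=
  A ⊆ M ∧ Orthonormal 𝕜 (Subtype.val : A → S) ∧
    ∀ x ∈ M, (∀ a ∈ A, inner 𝕜 a x = 0) → x = 0

theorem exists_isMONS (M : Submodule 𝕜 S) : ∃ A : Set S, IsMONS M A := by
  obtain ⟨w, -, hw, hmax⟩ := exists_maximal_orthonormal (𝕜 := 𝕜) (E := M)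
    (s := ∅) ⟨fun i => i.2.elim, fun i => i.2.elim⟩
  refine ⟨Subtype.val '' w, ?_, ?_, ?_⟩
  · rintro _ ⟨a, -, rfl⟩
    exact a.2
  · have h1 := hw.comp_linearIsometry M.subtypeₗᵢ
    have h2 := h1.toSubtypeRange
    convert h2 using 2
    · simp [Set.range_comp]
    · simp [Set.range_comp]
  · intro x hxM hx
    have hbot := (maximal_orthonormal_iff_orthogonalComplement_eq_bot hw).1
      fun u hu hon => (hmax u hu hon).symm ▸ rfl
    have hmem : (⟨x, hxM⟩ : M) ∈ (Submodule.span 𝕜 w)ᗮ := by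
      rw [Submodule.mem_orthogonal]
      intro y hy
      induction hy using Submodule.span_induction with
      | mem y hy => exact hx y ⟨y, hy, rfl⟩
      | zero => simp
      | add y z _ _ h1 h2 => rw [inner_add_left, h1, h2, add_zero]
      | smul c y _ h => rw [inner_smul_left, h, mul_zero]
    rw [hbot, Submodule.mem_bot] at hmem
    exact congrArg Subtype.val hmem

/-- The orthogonal dimension `dim M`: the cardinality of a maximal orthonormal system in `M`.
All of them have the same cardinality. -/
noncomputable def orthDim (M : Submodule 𝕜 S) : Cardinal :=
  Cardinal.mk ↥(Classical.choose (exists_isMONS M))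

end Logic

end PreHilbert

/-! Every o-open neighbourhood `V` of `{0}` meets every o-open neighbourhood of `Aᗮᗮ`, for a
countable set `A` with `Aᗮᗮ` in `𝓛` and incomplete.

Let `M ∈ V` be finite-dimensional and let `v` be a vector of the completion `H` that is not in `S`.
The subspaces `Gᗮ`, for `G` a finite-dimensional subspace of `S` orthogonal to `M` and to `v`,
decrease to `(M + [v]) ∩ S = M`. If `v` is also a limit of vectors of `D = span A`, then each `Gᗮ`
contains some `u ∈ D` as close to `v` as desired, and `M ≤ M + [u] ≤ Gᗮ`; as `V` is o-open, some
`M + [u]` lies in `V`. Incompleteness of `Aᗮᗮ` makes such `v` abundant near every vector of `D`, so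
that one can start at `{0}` and add one vector at a time without leaving `V`, the vectors being
dense around `A`. The resulting increasing sequence in `V` has supremum `Aᗮᗮ`.

In (i), `A` is a Cauchy sequence without limit in `S`, orthogonalized to obtain atoms; in (ii), `A`
is a maximal orthonormal system of the given splitting subspace. -/

open scoped Topology

namespace PreHilbert

section OrderTopology

variable {P : Type*} [PartialOrder P] {V : Set P} {Γ : Type*} [Preorder Γ] [IsDirectedOrder Γ]
  [Nonempty Γ] {l : P}

theorem exists_mem_of_oConverges (hV : IsOpen[oTopology P] V) {x : Γ → P} (hx : OConverges x l)
    (hl : l ∈ V) : ∃ γ, x γ ∈ V := by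
  by_contra! hxV
  let := oTopology P
  have hVc : IsOClosed Vᶜ := (isClosed_oTopology_iff _).1 hV.isClosed_compl
  exact hVc.mem_of_oConverges x l hxV hx hl

theorem exists_mem_of_isLUB (hV : IsOpen[oTopology P] V) {x : Γ → P} (hx : Monotone x)
    (hxl : IsLUB (Set.range x) l) (hl : l ∈ V) : ∃ γ, x γ ∈ V :=
  exists_mem_of_oConverges hV
    ⟨x, fun _ => l, fun γ => ⟨le_rfl, hxl.1 ⟨γ, rfl⟩⟩, ⟨hx, hxl⟩, antitone_const,
      by simp only [Set.range_const, isGLB_singleton]⟩ hl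

theorem exists_mem_of_isGLB_of_le (hV : IsOpen[oTopology P] V) {x b : Γ → P} (hb : Antitone b)
    (hbl : IsGLB (Set.range b) l) (hlx : ∀ γ, l ≤ x γ) (hxb : ∀ γ, x γ ≤ b γ) (hl : l ∈ V) :
    ∃ γ, x γ ∈ V :=
  exists_mem_of_oConverges hV
    ⟨fun _ => l, b, fun γ => ⟨hlx γ, hxb γ⟩,
      ⟨monotone_const, by simp only [Set.range_const, isLUB_singleton]⟩, hb, hbl⟩ hl

end OrderTopology

section TopologicalClosure

variable {𝕜 : Type*} [NontriviallyNormedField 𝕜] {E : Type*} [AddCommGroup E] [Module 𝕜 E]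
  [TopologicalSpace E] [IsTopologicalAddGroup E] [ContinuousSMul 𝕜 E]

theorem topologicalClosure_inf_ker [CompleteSpace 𝕜] {F : Type*} [AddCommGroup F] [Module 𝕜 F]
    [TopologicalSpace F] [IsTopologicalAddGroup F] [ContinuousSMul 𝕜 F] [T2Space F]
    [FiniteDimensional 𝕜 F] (D : Submodule 𝕜 E) (f : E →L[𝕜] F) :
    (D ⊓ f.ker).topologicalClosure = D.topologicalClosure ⊓ f.ker := by
  refine le_antisymm (le_inf (Submodule.topologicalClosure_mono inf_le_left)
    (Submodule.topologicalClosure_minimal _ inf_le_right f.isClosed_ker)) ?_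
  obtain ⟨s, hs⟩ : ∃ s : F →ₗ[𝕜] D, ∀ d : D, f (s (f d)) = f d := by
    let p : D →ₗ[𝕜] F := f.toLinearMap ∘ₗ D.subtype
    obtain ⟨s₀, hs₀⟩ := p.rangeRestrict.exists_rightInverse_of_surjective p.range_rangeRestrict
    obtain ⟨s, rfl⟩ := LinearMap.exists_extend s₀
    exact ⟨s, fun d => congrArg Subtype.val (LinearMap.congr_fun hs₀ (p.rangeRestrict d))⟩
  rintro v ⟨hvD, hfv⟩
  -- `x ↦ x - s (f x)` is continuous, maps `D` into `D ⊓ ker f`, and fixes `v`.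
  have hcont : Continuous fun x : E => x - (s (f x) : E) :=
    continuous_id.sub
      ((LinearMap.continuous_of_finiteDimensional (D.subtype ∘ₗ s)).comp f.continuous)
  have hmaps : Set.MapsTo (fun x : E => x - (s (f x) : E)) D (D ⊓ f.ker : Submodule 𝕜 E) :=
    fun d hd => ⟨sub_mem hd (s (f d)).2, by simpa [sub_eq_zero] using (hs ⟨d, hd⟩).symm⟩
  have hv := map_mem_closure hcont hvD hmaps
  rwa [show f v = 0 from hfv, map_zero, Submodule.coe_zero, sub_zero] at hv

theorem subset_closure_diff_of_not_le {D R : Submodule 𝕜 E} (h : ¬ D ≤ R) :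
    (D : Set E) ⊆ closure (D \ R) := by
  obtain ⟨v, hvD, hvR⟩ := SetLike.not_le_iff_exists.1 h
  intro d hd
  by_cases hdR : d ∈ R
  · have htendsto : Filter.Tendsto (fun c : 𝕜 => d + c • v) (𝓝[≠] 0) (𝓝 d) := by
      have hcont : Continuous fun c : 𝕜 => d + c • v := by fun_prop
      simpa using (hcont.tendsto 0).mono_left nhdsWithin_le_nhds
    refine mem_closure_of_tendsto htendsto ?_
    filter_upwards [self_mem_nhdsWithin] with c hc
    refine ⟨add_mem hd (D.smul_mem c hvD), fun hcR => hvR ?_⟩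
    exact (R.smul_mem_iff hc).1 ((R.add_mem_iff_right hdR).1 hcR)
  · exact subset_closure ⟨hd, hdR⟩

end TopologicalClosure

theorem isComplete_closure_of_closure_image_subset_range {X Y : Type*} [UniformSpace X]
    [UniformSpace Y] [CompleteSpace Y] {f : X → Y} (hf : IsUniformInducing f) {A : Set X}
    (h : closure (f '' A) ⊆ Set.range f) : IsComplete (closure A) := by
  rw [← isComplete_image_iff hf, hf.isInducing.closure_eq_preimage_closure_image,
    Set.image_preimage_eq_of_subset h]
  exact isClosed_closure.isComplete

variable {𝕜 : Type*} [RCLike 𝕜] {S : Type*} [NormedAddCommGroup S] [InnerProductSpace 𝕜 S]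

section LinearIsometry

variable {H : Type*} [NormedAddCommGroup H] [InnerProductSpace 𝕜 H] (ι : S →ₗᵢ[𝕜] H)

theorem comap_orthogonal_map (K : Submodule 𝕜 S) :
    (K.map ι.toLinearMap)ᗮ.comap ι.toLinearMap = Kᗮ := by
  ext x
  simp [Submodule.mem_orthogonal]

theorem topologicalClosure_map_inf_orthogonal (D G : Submodule 𝕜 S) [FiniteDimensional 𝕜 G] :
    ((D ⊓ Gᗮ).map ι.toLinearMap).topologicalClosure =
      (D.map ι.toLinearMap).topologicalClosure ⊓ (G.map ι.toLinearMap)ᗮ := by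
  rw [← comap_orthogonal_map ι G, ← Submodule.map_inf_eq_map_inf_comap,
    ← Submodule.ker_orthogonalProjectionOnto, topologicalClosure_inf_ker]

theorem orthogonal_comap_orthogonal (hι : DenseRange ι) (M : Submodule 𝕜 H)
    [FiniteDimensional 𝕜 M] :
    (Mᗮ.comap ι.toLinearMap)ᗮ = M.comap ι.toLinearMap := by
  have hdense : (ι.toLinearMap.range ⊓ Mᗮ).topologicalClosure = Mᗮ := by
    have hrange : ι.toLinearMap.range.topologicalClosure = ⊤ :=
      Submodule.dense_iff_topologicalClosure_eq_top.1 hι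
    rw [← M.ker_orthogonalProjectionOnto, topologicalClosure_inf_ker, hrange, top_inf_eq]
  rw [← comap_orthogonal_map ι, Submodule.map_comap_eq, ← Submodule.orthogonal_closure, hdense,
    M.orthogonal_orthogonal]

theorem comap_map_sup_span_singleton (M : Submodule 𝕜 S) {v : H} (hv : v ∉ Set.range ι) :
    (M.map ι.toLinearMap ⊔ Submodule.span 𝕜 {v}).comap ι.toLinearMap = M := by
  refine le_antisymm (fun x hx => ?_) (Submodule.map_le_iff_le_comap.1 le_sup_left)
  obtain ⟨_, ⟨z, hz, rfl⟩, _, hw, hzw⟩ := Submodule.mem_sup.1 hx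
  obtain ⟨c, rfl⟩ := Submodule.mem_span_singleton.1 hw
  have hcv : c • v = ι (x - z) := by
    rw [map_sub]
    exact eq_sub_of_add_eq' hzw
  have hc : c = 0 := by
    by_contra hc
    exact hv ((ι.toLinearMap.range.smul_mem_iff hc).1 ⟨x - z, hcv.symm⟩)
  rw [hc, zero_smul, eq_comm, map_eq_zero_iff ι ι.injective, sub_eq_zero] at hcv
  rwa [hcv]

theorem isComplete_orthogonal_orthogonal [CompleteSpace H] {D : Submodule 𝕜 S}
    (h : (D.map ι.toLinearMap).topologicalClosure ≤ ι.toLinearMap.range) :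
    IsComplete (Dᗮᗮ : Set S) := by
  have hD : IsComplete (D.topologicalClosure : Set S) :=
    isComplete_closure_of_closure_image_subset_range ι.isometry.isUniformInducing h
  have := hD.completeSpace_coe
  rwa [← D.orthogonal_closure, Submodule.orthogonal_orthogonal]

end LinearIsometry

namespace Logic

variable (L : Logic 𝕜 S)

theorem mem_of_finiteDimensional (M : Submodule 𝕜 S) [FiniteDimensional 𝕜 M] : M ∈ L := by
  classical
  obtain ⟨s, rfl⟩ : M.FG := Module.Finite.iff_fg.1 inferInstance
  induction s using Finset.induction with
  | empty =>
    rw [Finset.coe_empty, Submodule.span_empty]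
    exact L.bot_mem
  | insert a s _ ih =>
    rw [Finset.coe_insert, Submodule.span_insert, sup_comm]
    exact L.sup_span_mem _ ih a

/-- A finite-dimensional subspace of `S`, regarded as an element of the logic `𝓛`. -/
def ofFiniteDimensional (M : Submodule 𝕜 S) [FiniteDimensional 𝕜 M] : L :=
  ⟨M, L.mem_of_finiteDimensional M⟩

theorem isAtom_ofFiniteDimensional_span_singleton {x : S} (hx : x ≠ 0) :
    IsAtom (L.ofFiniteDimensional (Submodule.span 𝕜 {x})) := by
  have hatom := nonzero_span_atom (K := 𝕜) x hx
  exact ⟨fun h => hatom.1 (congrArg Subtype.val h), fun M hM => Subtype.ext (hatom.2 M hM)⟩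

/-- The orthocomplementation `M ↦ Mᗮ` of the logic `𝓛`. -/
def orthogonal (M : L) : L :=
  ⟨(M : Submodule 𝕜 S)ᗮ, L.orthogonal_mem M M.2⟩

variable {L}

theorem isLUB_range_iff {κ : Type*} {f : κ → L} {s : L} :
    IsLUB (Set.range f) s ↔ (s : Submodule 𝕜 S) = (⨆ i, (f i : Submodule 𝕜 S))ᗮᗮ := by
  have hle {M : L} (hM : M ∈ upperBounds (Set.range f)) :
      (⨆ i, (f i : Submodule 𝕜 S))ᗮᗮ ≤ M := by
    rw [← L.orthClosed M M.2]
    exact Submodule.orthogonal_orthogonal_monotone (iSup_le fun i => hM ⟨i, rfl⟩)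
  constructor
  · refine fun hs => le_antisymm (fun z hz => ?_) (hle hs.1)
    rw [Submodule.mem_orthogonal]
    intro x hx
    rw [← Submodule.iInf_orthogonal, Submodule.mem_iInf] at hx
    have hsx : s ≤ L.orthogonal (L.ofFiniteDimensional (Submodule.span 𝕜 {x})) :=
      hs.2 (Set.forall_mem_range.2 fun i y hy =>
        Submodule.mem_orthogonal_singleton_iff_inner_left.2 (hx i y hy))
    exact Submodule.mem_orthogonal_singleton_iff_inner_right.1 (hsx hz)
  · refine fun hs => ⟨Set.forall_mem_range.2 fun i => ?_, fun M hM => hs.trans_le (hle hM)⟩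
    change (f i : Submodule 𝕜 S) ≤ s
    rw [hs]
    exact (le_iSup (fun i => (f i : Submodule 𝕜 S)) i).trans (Submodule.le_orthogonal_orthogonal _)

theorem isGLB_range_orthogonal_span_finset {N : Submodule 𝕜 S} {y : L}
    (hy : (y : Submodule 𝕜 S) = Nᗮ) :
    IsGLB (Set.range fun s : Finset N =>
      L.orthogonal (L.ofFiniteDimensional ((Submodule.span 𝕜 (s : Set N)).map N.subtype))) y := by
  constructor
  · refine Set.forall_mem_range.2 fun s => ?_
    change (y : Submodule 𝕜 S) ≤ _
    rw [hy]
    exact Submodule.orthogonal_le (N.map_subtype_le _)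
  · intro z hz
    change (z : Submodule 𝕜 S) ≤ y
    rw [hy]
    intro x hx g hg
    refine hz (Set.mem_range_self {⟨g, hg⟩}) hx g ⟨⟨g, hg⟩, ?_, rfl⟩
    rw [Finset.coe_singleton]
    exact Submodule.mem_span_singleton_self _

section Completion

variable {H : Type*} [NormedAddCommGroup H] [InnerProductSpace 𝕜 H] (ι : S →ₗᵢ[𝕜] H) {V : Set L}

theorem mem_closure_image_sup_span_singleton_mem (hι : DenseRange ι) (hV : IsOpen[oTopology L] V)
    {M : Submodule 𝕜 S} [FiniteDimensional 𝕜 M] (hM : L.ofFiniteDimensional M ∈ V)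
    {D : Submodule 𝕜 S} {v : H} (hvD : v ∈ (D.map ι.toLinearMap).topologicalClosure)
    (hv : v ∉ Set.range ι) :
    v ∈ closure (ι '' {u ∈ D | L.ofFiniteDimensional (M ⊔ Submodule.span 𝕜 {u}) ∈ V}) := by
  let K : Submodule 𝕜 H := M.map ι.toLinearMap ⊔ Submodule.span 𝕜 {v}
  let N : Submodule 𝕜 S := Kᗮ.comap ι.toLinearMap
  let G (s : Finset N) : Submodule 𝕜 S := (Submodule.span 𝕜 (s : Set N)).map N.subtype
  have hGN (s : Finset N) : G s ≤ N := N.map_subtype_le _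
  have hN : M = Nᗮ := by
    rw [orthogonal_comap_orthogonal ι hι K, comap_map_sup_span_singleton ι M hv]
  have hvG (s : Finset N) : v ∈ ((G s).map ι.toLinearMap)ᗮ :=
    Submodule.orthogonal_le (Submodule.map_le_iff_le_comap.2 (hGN s))
      (K.le_orthogonal_orthogonal (Submodule.mem_sup_right (Submodule.mem_span_singleton_self v)))
  have hvDG (s : Finset N) : v ∈ ((D ⊓ (G s)ᗮ).map ι.toLinearMap).topologicalClosure := by
    rw [topologicalClosure_map_inf_orthogonal]
    exact ⟨hvD, hvG s⟩
  rw [Metric.mem_closure_iff]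
  intro ε hε
  have hu (s : Finset N) : ∃ u ∈ D ⊓ (G s)ᗮ, dist v (ι u) < ε := by
    obtain ⟨_, ⟨u, hu, rfl⟩, huv⟩ := Metric.mem_closure_iff.1 (hvDG s) ε hε
    exact ⟨u, hu, huv⟩
  choose u hu huv using hu
  have hMG (s : Finset N) : M ≤ (G s)ᗮ := hN.trans_le (Submodule.orthogonal_le (hGN s))
  obtain ⟨s, hs⟩ := exists_mem_of_isGLB_of_le hV
    (x := fun s => L.ofFiniteDimensional (M ⊔ Submodule.span 𝕜 {u s}))
    (b := fun s => L.orthogonal (L.ofFiniteDimensional (G s)))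
    (fun s t hst => Submodule.orthogonal_le
      (Submodule.map_mono (Submodule.span_mono (Finset.coe_subset.2 hst))))
    (isGLB_range_orthogonal_span_finset hN)
    (fun s => (le_sup_left : M ≤ M ⊔ Submodule.span 𝕜 {u s}))
    (fun s => sup_le (hMG s) ((Submodule.span_singleton_le_iff_mem _ _).2 (hu s).2)) hM
  exact ⟨ι (u s), ⟨u s, ⟨(hu s).1, hs⟩, rfl⟩, huv s⟩

theorem subset_closure_sup_span_singleton_mem (hι : DenseRange ι) (hV : IsOpen[oTopology L] V)
    {M : Submodule 𝕜 S} [FiniteDimensional 𝕜 M] (hM : L.ofFiniteDimensional M ∈ V)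
    {D : Submodule 𝕜 S}
    (hD : ¬ (D.map ι.toLinearMap).topologicalClosure ≤ ι.toLinearMap.range) :
    (D : Set S) ⊆
      closure {u ∈ D | L.ofFiniteDimensional (M ⊔ Submodule.span 𝕜 {u}) ∈ V} := by
  intro d hd
  rw [ι.isometry.isUniformInducing.isInducing.closure_eq_preimage_closure_image]
  have hιd : ι d ∈ (D.map ι.toLinearMap).topologicalClosure :=
    Submodule.le_topologicalClosure _ ⟨d, hd, rfl⟩
  refine closure_minimal (fun v hv => ?_) isClosed_closure (subset_closure_diff_of_not_le hD hιd)
  exact mem_closure_image_sup_span_singleton_mem ι hι hV hM hv.1 hv.2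

theorem exists_monotone_seq_mem_inter_nonempty (hι : DenseRange ι) (hV : IsOpen[oTopology L] V)
    (hbot : ⊥ ∈ V) {D : Submodule 𝕜 S}
    (hD : ¬ (D.map ι.toLinearMap).topologicalClosure ≤ ι.toLinearMap.range)
    {O : ℕ → Set S} (hO : ∀ n, IsOpen (O n)) (hOD : ∀ n, (O n ∩ D).Nonempty) :
    ∃ F : ℕ → L, Monotone F ∧ (∀ n, F n ∈ V) ∧ (∀ n, (F n : Submodule 𝕜 S) ≤ D) ∧
      ∀ n, (O n ∩ F (n + 1)).Nonempty := by
  let T := {M : L // M ∈ V ∧ FiniteDimensional 𝕜 (M : Submodule 𝕜 S) ∧ (M : Submodule 𝕜 S) ≤ D}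
  have hnext (n : ℕ) (M : T) : ∃ M' : T, M.1 ≤ M'.1 ∧ (O n ∩ M'.1).Nonempty := by
    obtain ⟨M, hMV, hM, hMD⟩ := M
    obtain ⟨d, hdO, hdD⟩ := hOD n
    obtain ⟨u, huO, huD, huV⟩ := mem_closure_iff.1
      (subset_closure_sup_span_singleton_mem ι hι hV (M := M) hMV hD hdD) (O n) (hO n) hdO
    exact ⟨⟨_, huV, Submodule.finiteDimensional_sup _ _,
        sup_le hMD ((Submodule.span_singleton_le_iff_mem u D).2 huD)⟩,
      (le_sup_left : (M : Submodule 𝕜 S) ≤ (M : Submodule 𝕜 S) ⊔ Submodule.span 𝕜 {u}),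
      ⟨u, huO, Submodule.mem_sup_right (Submodule.mem_span_singleton_self u)⟩⟩
  choose next hle hmeets using hnext
  let F : ℕ → T := Nat.rec ⟨⊥, hbot, finiteDimensional_bot 𝕜 S, bot_le⟩ next
  exact ⟨fun n => (F n).1, monotone_nat_of_le_succ fun n => hle n (F n), fun n => (F n).2.1,
    fun n => (F n).2.2.2, fun n => hmeets n (F n)⟩

theorem exists_monotone_seq_mem_subset_closure (hι : DenseRange ι) (hV : IsOpen[oTopology L] V)
    (hbot : ⊥ ∈ V) {D : Submodule 𝕜 S}
    (hD : ¬ (D.map ι.toLinearMap).topologicalClosure ≤ ι.toLinearMap.range)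
    {A : Set S} (hA : A.Countable) (hAD : A ⊆ D) :
    ∃ F : ℕ → L, Monotone F ∧ (∀ n, F n ∈ V) ∧ (∀ n, (F n : Submodule 𝕜 S) ≤ D) ∧
      A ⊆ closure (⋃ n, (F n : Set S)) := by
  obtain ⟨a, ha⟩ := (hA.insert 0).exists_eq_range (Set.insert_nonempty 0 A)
  have haD (k : ℕ) : a k ∈ D := by
    have hak : a k ∈ insert 0 A := ha ▸ Set.mem_range_self k
    exact Set.insert_subset D.zero_mem hAD hak
  obtain ⟨F, hF, hFV, hFD, hmeets⟩ := exists_monotone_seq_mem_inter_nonempty ι hι hV hbot hD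
    (O := fun n => Metric.ball (a n.unpair.1) (1 / (n.unpair.2 + 1)))
    (fun _ => Metric.isOpen_ball)
    (fun n => ⟨a n.unpair.1, Metric.mem_ball_self Nat.one_div_pos_of_nat, haD _⟩)
  refine ⟨F, hF, hFV, hFD, fun x hx => Metric.mem_closure_iff.2 fun ε hε => ?_⟩
  obtain ⟨k, rfl⟩ : x ∈ Set.range a := ha ▸ Set.mem_insert_of_mem 0 hx
  obtain ⟨m, hm⟩ := exists_nat_one_div_lt hε
  obtain ⟨u, hu, huF⟩ := hmeets (Nat.pair k m)
  rw [Nat.unpair_pair, Metric.mem_ball'] at hu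
  exact ⟨u, Set.mem_iUnion_of_mem _ huF, hu.trans hm⟩

end Completion

variable (L) in
theorem not_t2Space_of_countable {A : Set S} (hA : A.Countable)
    (hL : (Submodule.span 𝕜 A)ᗮᗮ ∈ L)
    (hincomplete : ¬ IsComplete ((Submodule.span 𝕜 A)ᗮᗮ : Set S)) :
    ¬ @T2Space L (oTopology L) := by
  intro hT2
  let ι : S →ₗᵢ[𝕜] UniformSpace.Completion S := UniformSpace.Completion.toComplₗᵢ
  let D := Submodule.span 𝕜 A
  let U : L := ⟨Dᗮᗮ, hL⟩
  have hU : ⊥ ≠ U := by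
    intro h
    have hbot : Dᗮᗮ = ⊥ := (congrArg Subtype.val h).symm
    exact hincomplete (hbot ▸ isCompact_singleton.isComplete)
  obtain ⟨V, W, hV, hW, hbotV, hUW, hVW⟩ := hT2.t2 hU
  obtain ⟨F, hF, hFV, hFD, hAF⟩ := exists_monotone_seq_mem_subset_closure ι
    UniformSpace.Completion.denseRange_coe hV hbotV
    (mt (isComplete_orthogonal_orthogonal ι) hincomplete) hA Submodule.subset_span
  have hDF : D ≤ (⨆ n, (F n : Submodule 𝕜 S)).topologicalClosure :=
    Submodule.span_le.2 (hAF.trans (closure_mono (Set.iUnion_subset fun n =>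
      le_iSup (fun n => (F n : Submodule 𝕜 S)) n)))
  have hFU : IsLUB (Set.range F) U := by
    refine isLUB_range_iff.2 (le_antisymm ?_
      (Submodule.orthogonal_orthogonal_monotone (iSup_le hFD)))
    rw [← Submodule.orthogonal_closure (⨆ n, (F n : Submodule 𝕜 S))]
    exact Submodule.orthogonal_orthogonal_monotone hDF
  obtain ⟨n, hFW⟩ := exists_mem_of_isLUB hW hF hFU hUW
  exact Set.disjoint_left.1 hVW (hFV n) hFW

end Logic

theorem exists_seq_not_isComplete (hS : ¬ CompleteSpace S) :
    ∃ d : ℕ → S, ¬ IsComplete ((Submodule.span 𝕜 (Set.range d))ᗮᗮ : Set S) := by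
  by_contra! h
  refine hS (Metric.complete_of_cauchySeq_tendsto fun d hd => ?_)
  have hd_mem (n : ℕ) : d n ∈ (Submodule.span 𝕜 (Set.range d))ᗮᗮ :=
    Submodule.le_orthogonal_orthogonal _ (Submodule.subset_span ⟨n, rfl⟩)
  obtain ⟨x, -, hx⟩ := cauchySeq_tendsto_of_isComplete (h d) hd_mem hd
  exact ⟨x, hx⟩

theorem exists_seq_ne_zero_orthogonal_span_eq (d : ℕ → S)
    (hd : ¬ FiniteDimensional 𝕜 (Submodule.span 𝕜 (Set.range d))) :
    ∃ e : ℕ → S, (∀ n, e n ≠ 0) ∧ Pairwise (fun m n => inner 𝕜 (e m) (e n) = 0) ∧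
      Submodule.span 𝕜 (Set.range e) = Submodule.span 𝕜 (Set.range d) := by
  let g := InnerProductSpace.gramSchmidt 𝕜 d
  have hspan : Submodule.span 𝕜 (Set.range g \ {0}) = Submodule.span 𝕜 (Set.range d) := by
    rw [Submodule.span_sdiff_singleton_zero, InnerProductSpace.span_gramSchmidt]
  have hg : {n | g n ≠ 0}.Infinite := by
    intro hfin
    refine hd (hspan ▸ FiniteDimensional.span_of_finite 𝕜 ((hfin.image g).subset ?_))
    rintro _ ⟨⟨n, rfl⟩, hn⟩
    exact ⟨n, hn, rfl⟩
  refine ⟨g ∘ Nat.nth (g · ≠ 0), Nat.nth_mem_of_infinite hg, fun m n hmn =>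
    InnerProductSpace.gramSchmidt_orthogonal 𝕜 d ((Nat.nth_injective hg).ne hmn), ?_⟩
  rw [← hspan, Set.range_comp, Nat.range_nth_of_infinite hg]
  congr 1
  aesop

theorem Logic.IsAtomicSigmaComplete.orthogonal_orthogonal_mem {L : Logic 𝕜 S}
    (hL : L.IsAtomicSigmaComplete) (d : ℕ → S) :
    (Submodule.span 𝕜 (Set.range d))ᗮᗮ ∈ L := by
  by_cases hd : FiniteDimensional 𝕜 (Submodule.span 𝕜 (Set.range d))
  · exact L.orthogonal_mem _ (L.orthogonal_mem _ (L.mem_of_finiteDimensional _))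
  · obtain ⟨e, he_ne, he_orth, hspan⟩ := exists_seq_ne_zero_orthogonal_span_eq d hd
    obtain ⟨s, hs⟩ := hL (fun n => L.ofFiniteDimensional (Submodule.span 𝕜 {e n}))
      (fun n => L.isAtom_ofFiniteDimensional_span_singleton (he_ne n))
      (fun m n hmn => Submodule.isOrtho_span.2 (by rintro _ rfl _ rfl; exact he_orth hmn))
    rw [← hspan, Submodule.span_range_eq_iSup]
    exact Logic.isLUB_range_iff.1 hs ▸ s.2

theorem IsMONS.orthogonal_span {U : Submodule 𝕜 S} {A : Set S} (hA : IsMONS U A)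
    (hU : IsSplitting U) : (Submodule.span 𝕜 A)ᗮ = Uᗮ := by
  refine le_antisymm (fun x hx => ?_) (Submodule.orthogonal_le (Submodule.span_le.2 hA.1))
  obtain ⟨y, hy, z, hz, rfl⟩ := Submodule.mem_sup.1 (hU.sup_eq_top ▸ Submodule.mem_top (x := x))
  have hy0 : y = 0 := by
    refine hA.2.2 y hy fun a ha => ?_
    have h := hx a (Submodule.subset_span ha)
    rwa [inner_add_right, hz a (hA.1 ha), add_zero] at h
  rwa [hy0, zero_add]

theorem IsSplitting.exists_countable_orthogonal_span_eq {U : Submodule 𝕜 S} (hU : IsSplitting U)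
    (hdim : orthDim U ≤ Cardinal.aleph0) :
    ∃ A : Set S, A.Countable ∧ (Submodule.span 𝕜 A)ᗮ = Uᗮ :=
  ⟨_, Cardinal.le_aleph0_iff_set_countable.1 hdim,
    (Classical.choose_spec (exists_isMONS U)).orthogonal_span hU⟩

end PreHilbert

theorem corollary25 {𝕜 : Type*} [RCLike 𝕜] {S : Type*} [NormedAddCommGroup S]
    [InnerProductSpace 𝕜 S] (hS : ¬ CompleteSpace S) :
    (∀ L : PreHilbert.Logic 𝕜 S, L.IsAtomicSigmaComplete →
      ¬ @T2Space L (PreHilbert.oTopology L)) ∧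
    ¬ @T2Space (PreHilbert.orthClosedLogic 𝕜 S)
      (PreHilbert.oTopology (PreHilbert.orthClosedLogic 𝕜 S)) ∧
    (∀ L : PreHilbert.Logic 𝕜 S,
      (∃ U ∈ L, PreHilbert.IsSplitting U ∧ ¬ IsComplete (U : Set S) ∧
        PreHilbert.orthDim U ≤ Cardinal.aleph0) →
      ¬ @T2Space L (PreHilbert.oTopology L)) := by
  obtain ⟨d, hd⟩ := PreHilbert.exists_seq_not_isComplete (𝕜 := 𝕜) hS
  have hcountable := Set.countable_range d
  refine ⟨fun L hL => ?_, ?_, ?_⟩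
  · exact L.not_t2Space_of_countable hcountable (hL.orthogonal_orthogonal_mem d) hd
  · exact PreHilbert.Logic.not_t2Space_of_countable _ hcountable
      (congrArg Submodule.orthogonal Submodule.triorthogonal_eq_orthogonal) hd
  · rintro L ⟨U, hUL, hU, hincomplete, hdim⟩
    obtain ⟨A, hA, hAU⟩ := hU.exists_countable_orthogonal_span_eq hdim
    have hAUU : (Submodule.span 𝕜 A)ᗮᗮ = U := hAU ▸ L.orthClosed U hUL
    exact L.not_t2Space_of_countable hA (hAUU ▸ hUL) (hAUU ▸ hincomplete)
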